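/- **Setting.** Let $\mathcal V$ be a finite set, let $(\mathcal V,\mathcal I)$ and $(\mathcal V,\mathcal I')$ be matroids, and suppose that either $\mathcal I'$ is a uniform matroid (its independent sets are the sets with at most $k$ elements, for some integer $k\ge 0$), or $\mathcal I$ and $\mathcal I'$ are partition matroids with the same partition: $\mathcal V$ is the disjoint union of $\mathcal V_1,\dots,\mathcal V_n$, $\mathcal I=\{\mathcal A: |\mathcal A\cap\mathcal V_i|\le \alpha_i\ \forall i\}$ and $\mathcal I'=\{\mathcal B: |\mathcal B\cap\mathcal V_i|\le \beta_i\ \forall i\}$, with integers $\alpha_i,\beta_i\ge 0$. Let $f:2^{\mathcal V}\to\mathbb R$ be non-decreasing and non-negative with $f(\emptyset)=0$; write $f(v)=f(\{v\})$. Let $$f^\star=\max_{\mathcal A\in\mathcal I}\ \min_{\mathcal B\subseteq\mathcal A,\ \mathcal B\in\mathcal I'} f(\mathcal A\setminus\mathcal B),$$ and for $\mathcal A\subseteq\mathcal V$ let $\mathcal B^\star(\mathcal A)$ be any minimizer of $f(\mathcal A\setminus\mathcal B)$ over the sets $\mathcal B\subseteq\mathcal A$ with $\mathcal B\in\mathcal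 I'$. Let $\alpha,\beta$ be the ranks of $\mathcal I,\mathcal I'$ and $h(\alpha,\beta)=\max\left[\frac1{1+\beta},\frac1{\alpha-\beta}\right]$. Define $$\kappa_f=1-\min_{v}\frac{f(\mathcal V)-f(\mathcal V\setminus\{v\})}{f(v)},\qquad c_f=1-\min_{v}\ \min_{\mathcal A,\mathcal B\subseteq\mathcal V\setminus\{v\}}\frac{f(\{v\}\cup\mathcal A)-f(\mathcal A)}{f(\{v\}\cup\mathcal B)-f(\mathcal B)},$$ where the minima range over the choices with non-zero denominator. Call $f$ submodular if $f(\mathcal A\cup\{v\})-f(\mathcal A)\ge f(\mathcal A'\cup\{v\})-f(\mathcal A')$ for all $\mathcal A\subseteq\mathcal A'\subseteq\mathcal V$ and $v\in\mathcal V$. **Algorithm 1.** Start with $\mathcal A_1=\mathcal R_1=\mathcal A_2=\mathcal R_2=\emptyset$. While $\mathcal R_1\ne\mathcal V$: take $x\in\arg\max_{y\in\mathcal V\setminus\mathcal R_1}f(y)$; if $\mathcal A_1\cup\{x\}$ is in both $\mathcal I$ and $\mathcal I'$, add $x$ to $\mathcal A_1$; add $x$ to $\mathcal R_1$. Then, while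 $\mathcal R_2\ne\mathcal V\setminus\mathcal A_1$: take $x\in\arg\max_{y\in\mathcal V\setminus(\mathcal A_1\cup\mathcal R_2)}f(\mathcal A_2\cup\{y\})$; if $\mathcal A_1\cup\mathcal A_2\cup\{x\}\in\mathcal I$, add $x$ to $\mathcal A_2$; add $x$ to $\mathcal R_2$. Return $\mathcal A=\mathcal A_1\cup\mathcal A_2$. Ties are broken arbitrarily. **Theorem.** Algorithm 1 terminates, and for every way of breaking ties it uses $O(|\mathcal V|^2)$ evaluations of $f$ (with an absolute constant) and returns a set $\mathcal A\in\mathcal I$. Moreover, if $f^\star>0$: 1. Let $f$ be submodular and, if $\mathcal I'$ is not uniform, let $\beta_i\le\alpha_i$ for all $i$ (for some choice of the data $\mathcal V_i,\alpha_i,\beta_i$ as above). If $\mathcal I$ is a uniform matroid, then $$\frac{f(\mathcal A\setminus\mathcal B^\star(\mathcal A))}{f^\star}\ \ge\ \max\left[1-\kappa_f,h(\alpha,\beta)\right]\,\frac{1-e^{-\kappa_f}}{\kappa_f},$$ where the last factor is read as its limit $1$ if $\kappa_f=0$; and for any matroid $\mathcal I$, $$\frac{f(\mathcal A\setminus\mathcal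 B^\star(\mathcal A))}{f^\star}\ \ge\ \frac{\max\left[1-\kappa_f,h(\alpha,\beta)\right]}{1+\kappa_f}.$$ 2. If $f$ is submodular, both bounds of part 1 hold without the condition $\beta_i\le\alpha_i$ when $h(\alpha,\beta)$ is replaced by $\frac1{1+\beta}$. 3. For every $f$ as in the setting, submodular or not, $$\frac{f(\mathcal A\setminus\mathcal B^\star(\mathcal A))}{f^\star}\ \ge\ (1-c_f)^3.$$ -/

import Mathlib

universe u v

namespace ResilientMatroid

/-! ### Constraints -/

section Constraints

variable {V : Type u}

/-- A matroid whose independent sets are the sets of at most `k` elements, for some number `k`. -/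
def IsUniform (M : Matroid V) : Prop :=
  ∃ k : ℕ, ∀ A : Finset V, M.Indep (A : Set V) ↔ A.card ≤ k

/-- The independent sets are those with at most `a i` elements in each class
`{v | P v = i}` of the partition given by `P`. -/
def IsPartitionWith (M : Matroid V) {n : ℕ} (P : V → Fin n) (a : Fin n → ℕ) : Prop :=
  ∀ A : Finset V, M.Indep (A : Set V) ↔ ∀ i, (A.filter (fun v => P v = i)).card ≤ a i

/-- `M'` is a uniform matroid, or `M` and `M'` are partition matroids with the same partition. -/
def Admissible (M M' : Matroid V) : Prop :=
  IsUniform M' ∨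
    ∃ (n : ℕ) (P : V → Fin n) (a b : Fin n → ℕ), IsPartitionWith M P a ∧ IsPartitionWith M' P b

/-- As `Admissible`, where in the partition case the number of removals allowed in a class does
not exceed the number of selections allowed in it. -/
def Budgeted (M M' : Matroid V) : Prop :=
  IsUniform M' ∨
    ∃ (n : ℕ) (P : V → Fin n) (a b : Fin n → ℕ),
      (∀ i, b i ≤ a i) ∧ IsPartitionWith M P a ∧ IsPartitionWith M' P b

end Constraints

noncomputable section

variable {V : Type u} [Fintype V] [DecidableEq V]

/-! ### Set functions -/

/-- Diminishing marginal gains. -/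
def IsSubmodular (f : Finset V → ℝ) : Prop :=
  ∀ A B : Finset V, A ⊆ B → ∀ v : V, f (insert v B) - f B ≤ f (insert v A) - f A

/-- Curvature: `1 - min_v (f(V) - f(V \ {v})) / f(v)`, over the elements with `f(v) ≠ 0`. -/
def curvature (f : Finset V → ℝ) : ℝ :=
  1 - sInf {r : ℝ | ∃ v : V, f {v} ≠ 0 ∧
    r = (f Finset.univ - f (Finset.univ.erase v)) / f {v}}

/-- Total curvature: `1 -` the minimum of
`(f({v} ∪ A) - f(A)) / (f({v} ∪ B) - f(B))` over `v` and `A, B ⊆ V \ {v}` such that the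
denominator is not zero. -/
def totalCurvature (f : Finset V → ℝ) : ℝ :=
  1 - sInf {r : ℝ | ∃ (v : V) (A B : Finset V), v ∉ A ∧ v ∉ B ∧ f (insert v B) - f B ≠ 0 ∧
    r = (f (insert v A) - f A) / (f (insert v B) - f B)}

/-! ### The resilient maximization problem -/

/-- `min f(A \ B)` over the removals `B ⊆ A` that are independent in `M'`. -/
def worstValue (f : Finset V → ℝ) (M' : Matroid V) (A : Finset V) : ℝ :=
  ⨅ B : {B : Finset V // B ⊆ A ∧ M'.Indep (B : Set V)}, f (A \ B.1)

/-- The optimal value: `max min f(A \ B)` over the sets `A` that are independent in `M`. -/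
def optValue (f : Finset V → ℝ) (M M' : Matroid V) : ℝ :=
  ⨆ A : {A : Finset V // M.Indep (A : Set V)}, worstValue f M' A.1

/-- `B` is an optimal (worst-case) removal from `A`. -/
def IsWorstRemoval (f : Finset V → ℝ) (M' : Matroid V) (A B : Finset V) : Prop :=
  (B ⊆ A ∧ M'.Indep (B : Set V)) ∧
    ∀ B' : Finset V, B' ⊆ A → M'.Indep (B' : Set V) → f (A \ B) ≤ f (A \ B')

/-! ### Programs that access a set function through evaluations only -/

end

/-- A program over the ground set `V` with result in `β`: it returns, or asks for the value of the
set function at a set, or picks an arbitrary element of a finite set (breaking of ties). -/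
inductive Prog (V : Type u) (β : Type v) : Type (max u v)
  | ret (b : β) : Prog V β
  | query (S : Finset V) (k : ℝ → Prog V β) : Prog V β
  | choose (s : Finset V) (k : {x : V // x ∈ s} → Prog V β) : Prog V β

/-- `Runs f p b n`: some execution of `p` on the set function `f` returns `b` after exactly `n`
evaluations of `f`. -/
inductive Runs {V : Type u} {β : Type v} (f : Finset V → ℝ) : Prog V β → β → ℕ → Prop
  | ret (b : β) : Runs f (Prog.ret b) b 0
  | query (S : Finset V) (k : ℝ → Prog V β) (b : β) (n : ℕ) (h : Runs f (k (f S)) b n) :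
      Runs f (Prog.query S k) b (n + 1)
  | choose (s : Finset V) (k : {x : V // x ∈ s} → Prog V β) (x : {x : V // x ∈ s}) (b : β) (n : ℕ)
      (h : Runs f (k x) b n) : Runs f (Prog.choose s k) b n

noncomputable section

variable {V : Type u} [Fintype V] [DecidableEq V] {β : Type v}

/-- Evaluate the set function at `S y` for each `y` in the list, record the values (starting from
the table `val`), and continue with the resulting table. -/
def evalList (S : V → Finset V) : List V → (V → ℝ) → ((V → ℝ) → Prog V β) → Prog V β
  | [], val, k => k val
  | y :: l, val, k => Prog.query (S y) fun r => evalList S l (Function.update val y r) k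

/-- The elements of `s` at which `val` is largest. -/
def argmaxOn (s : Finset V) (val : V → ℝ) : Finset V := by
  classical exact s.filter (fun x => ∀ y ∈ s, val y ≤ val x)

/-- Evaluate the set function at `S y` for each `y ∈ s`, and continue with an arbitrary maximizer
`x ∈ s`. -/
def pickMax (s : Finset V) (S : V → Finset V) (k : {x : V // x ∈ s} → Prog V β) : Prog V β :=
  evalList S s.toList (fun _ => 0) fun val =>
    Prog.choose (argmaxOn s val) fun x => k ⟨x.1, by
      have hx := x.2
      simp only [argmaxOn, Finset.mem_filter] at hx
      exact hx.1⟩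

open Classical in
/-- First loop, with the current sets `A₁` and `R₁`:
while `R₁ ≠ V`, take `x ∈ argmax f(y)` over `y ∈ V \ R₁`, add `x` to `A₁` if the result is
independent in both `M` and `M'`, and add `x` to `R₁`. -/
def loop1 (M M' : Matroid V) (k : Finset V → Prog V β) (A₁ R₁ : Finset V) : Prog V β :=
  if R₁ ≠ Finset.univ then
    pickMax (Finset.univ \ R₁) (fun y => {y}) fun x =>
      loop1 M M' k
        (if M.Indep ((A₁ ∪ {x.1} : Finset V) : Set V) ∧ M'.Indep ((A₁ ∪ {x.1} : Finset V) : Set V)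
          then A₁ ∪ {x.1} else A₁)
        (R₁ ∪ {x.1})
  else k A₁
termination_by (Finset.univ \ R₁).card
decreasing_by
  refine Finset.card_lt_card ((Finset.ssubset_iff_of_subset ?_).2 ⟨x.1, x.2, ?_⟩)
  · exact Finset.sdiff_subset_sdiff (Finset.Subset.refl _) Finset.subset_union_left
  · simp

open Classical in
/-- Second loop, with the current sets `A₂` and `R₂`:
while `R₂ ≠ V \ A₁`, take `x ∈ argmax f(A₂ ∪ {y})` over `y ∈ V \ (A₁ ∪ R₂)`, add `x` to `A₂` if
`A₁ ∪ A₂ ∪ {x}` is independent in `M`, and add `x` to `R₂`. -/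
def loop2 (M : Matroid V) (A₁ : Finset V) (k : Finset V → Prog V β) (A₂ R₂ : Finset V) :
    Prog V β :=
  if R₂ ≠ Finset.univ \ A₁ then
    pickMax (Finset.univ \ (A₁ ∪ R₂)) (fun y => A₂ ∪ {y}) fun x =>
      loop2 M A₁ k
        (if M.Indep ((A₁ ∪ A₂ ∪ {x.1} : Finset V) : Set V) then A₂ ∪ {x.1} else A₂)
        (R₂ ∪ {x.1})
  else k A₂
termination_by (Finset.univ \ (A₁ ∪ R₂)).card
decreasing_by
  refine Finset.card_lt_card ((Finset.ssubset_iff_of_subset ?_).2 ⟨x.1, x.2, ?_⟩)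
  · exact Finset.sdiff_subset_sdiff (Finset.Subset.refl _)
      (Finset.union_subset_union (Finset.Subset.refl _) Finset.subset_union_left)
  · simp

/-- The algorithm: the bait set `A₁`, then the greedy set `A₂`; it returns `A₁ ∪ A₂`. -/
def algorithm (M M' : Matroid V) : Prog V (Finset V) :=
  loop1 M M' (fun A₁ => loop2 M A₁ (fun A₂ => Prog.ret (A₁ ∪ A₂)) ∅ ∅) ∅ ∅

/-! ### The quantities in the bounds -/

/-- `h(α, β) = max[1/(1+β), 1/(α-β)]`. -/
def hBound (α β : ℕ) : ℝ := max (1 / (1 + (β : ℝ))) (1 / ((α : ℝ) - (β : ℝ)))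

/-- `(1 - e^{-κ})/κ`, with its limit `1` at `κ = 0`. -/
def expRatio (κ : ℝ) : ℝ := if κ = 0 then 1 else (1 - Real.exp (-κ)) / κ

end

end ResilientMatroid

/-!
The algorithm returns `A = A₁ ∪ A₂`: a bait set `A₁`, independent in both matroids and filled in
order of decreasing singleton values, and a greedy set `A₂` of the contraction `M ／ A₁`
(`algorithm_spec`). Let `f⋆` be the optimal value and `B` a removal from `A`. Three comparisons,
between `f⋆`, `f A₂` and `f (A \ B)`, are multiplied.

* `f⋆ ≤ f O` for some `O` independent in `M ／ A₁` (`exists_optValue_le`). Extending `A₁` by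
  elements of an optimal set leaves out at most as many elements of the optimal set as `A₁` has,
  in each class of the partition, so the adversary may remove them. A uniform `M'` is treated as
  a partition matroid with a single class.
* `f A₂` is a constant fraction of `f O`, by induction along the greedy choices. A greedy
  element outside of `O` displaces at most one element of `O`, and that element was available
  with no larger gain (`GreedyPath.induction_completion`). With `X = f (S ∪ O) - f S` the value
  still missing at the greedy set `S`, and `a` the greedy gain, a step lowers `X` by at most `(1
  + κ) a`, which gives the factor `1 / (1 + κ)`. For a uniform matroid nothing has to be
  displaced: `X` is at most `a` times the number of missing elements, and falls by at most `κ a`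
  if the greedy element is not in `O`, which gives the exponential factor.
* The removal destroys little of `A₂`. A class in which elements of `A₂` are removed has a bait
  set that exhausts the budget and is at least as valuable element by element, so as many bait
  elements survive in it (`IsBait.card_removed_le`). Comparing sums of singleton values gives
  the factor `1 - κ` (or two factors `1 - c`); comparing single elements gives `1 / (1 + β)` and
  `1 / (α - β)`.
-/

namespace ResilientMatroid

open scoped Matroid

/-! ### Executions of the algorithm -/

section Execution

variable {V : Type u} {β : Type v} {f : Finset V → ℝ}

theorem runs_query_iff {S : Finset V} {k : ℝ → Prog V β} {b : β} {n : ℕ} :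
    Runs f (Prog.query S k) b n ↔ ∃ m, n = m + 1 ∧ Runs f (k (f S)) b m := by
  constructor
  · intro h
    cases h with
    | query _ _ _ m h => exact ⟨m, rfl, h⟩
  · rintro ⟨m, rfl, h⟩
    exact .query _ _ _ _ h

theorem runs_choose_iff {s : Finset V} {k : {x : V // x ∈ s} → Prog V β} {b : β} {n : ℕ} :
    Runs f (Prog.choose s k) b n ↔ ∃ x, Runs f (k x) b n := by
  constructor
  · intro h
    cases h with
    | choose _ _ x _ _ h => exact ⟨x, h⟩
  · rintro ⟨x, h⟩
    exact .choose _ _ x _ _ h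

variable [DecidableEq V]

theorem runs_evalList_iff {S : V → Finset V} {l : List V} {val : V → ℝ}
    {k : (V → ℝ) → Prog V β} {b : β} {n : ℕ} :
    Runs f (evalList S l val k) b n ↔
      ∃ m, n = m + l.length ∧ Runs f (k fun y => if y ∈ l then f (S y) else val y) b m := by
  induction l generalizing val n with
  | nil => simp [evalList]
  | cons y l ih =>
    have hval : (fun z => if z ∈ l then f (S z) else Function.update val y (f (S y)) z) =
        fun z => if z ∈ y :: l then f (S z) else val z := by
      funext z
      by_cases hz : z = y
      · subst hz; simp
      · simp [hz]
    simp only [evalList, runs_query_iff, ih, hval, List.length_cons]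
    constructor
    · rintro ⟨_, rfl, m, rfl, h⟩
      exact ⟨m, by ring, h⟩
    · rintro ⟨m, rfl, h⟩
      exact ⟨m + l.length, by ring, m, rfl, h⟩

variable [Fintype V]

theorem runs_pickMax_iff {s : Finset V} {S : V → Finset V} {k : {x : V // x ∈ s} → Prog V β}
    {b : β} {n : ℕ} :
    Runs f (pickMax s S k) b n ↔
      ∃ (x : {x : V // x ∈ s}) (m : ℕ), (∀ y ∈ s, f (S y) ≤ f (S x)) ∧ n = m + s.card ∧
        Runs f (k x) b m := by
  simp only [pickMax, runs_evalList_iff, runs_choose_iff, Finset.length_toList]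
  constructor
  · rintro ⟨m, rfl, ⟨x, hx⟩, h⟩
    simp only [argmaxOn, Finset.mem_filter] at hx
    refine ⟨⟨x, hx.1⟩, m, fun y hy => ?_, rfl, h⟩
    simpa [hx.1, hy] using hx.2 y hy
  · rintro ⟨⟨x, hx⟩, m, hmax, rfl, h⟩
    refine ⟨m, rfl, ⟨x, ?_⟩, h⟩
    simp only [argmaxOn, Finset.mem_filter]
    refine ⟨hx, fun y hy => ?_⟩
    simpa [hx, hy] using hmax y hy

theorem exists_runs_pickMax {s : Finset V} (hs : s.Nonempty) {S : V → Finset V}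
    {k : {x : V // x ∈ s} → Prog V β} (hk : ∀ x, ∃ b n, Runs f (k x) b n) :
    ∃ b n, Runs f (pickMax s S k) b n := by
  obtain ⟨x, hx, hmax⟩ := s.exists_max_image (fun y => f (S y)) hs
  obtain ⟨b, n, h⟩ := hk ⟨x, hx⟩
  exact ⟨b, n + s.card, runs_pickMax_iff.2 ⟨⟨x, hx⟩, n, hmax, rfl, h⟩⟩

theorem exists_runs_loop1 {M M' : Matroid V} {k : Finset V → Prog V β}
    (hk : ∀ A, ∃ b n, Runs f (k A) b n) (A R : Finset V) :
    ∃ b n, Runs f (loop1 M M' k A R) b n := by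
  induction hN : (Finset.univ \ R).card using Nat.strong_induction_on generalizing A R with
  | _ N ih =>
  rw [loop1]
  split_ifs with hR
  · refine exists_runs_pickMax ?_ fun x => ih _ ?_ _ _ rfl
    · rw [Finset.sdiff_nonempty]
      exact fun h => hR (Finset.univ_subset_iff.1 h)
    · rw [← hN, Finset.union_singleton, Finset.sdiff_insert]
      exact Finset.card_erase_lt_of_mem x.2
  · exact hk A

theorem exists_runs_loop2 {M : Matroid V} {A₁ : Finset V} {k : Finset V → Prog V β}
    (hk : ∀ A, ∃ b n, Runs f (k A) b n) (A R : Finset V) (hR : R ⊆ Finset.univ \ A₁) :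
    ∃ b n, Runs f (loop2 M A₁ k A R) b n := by
  induction hN : (Finset.univ \ (A₁ ∪ R)).card using Nat.strong_induction_on
    generalizing A R with
  | _ N ih =>
  rw [loop2]
  split_ifs with hne
  · refine exists_runs_pickMax ?_ fun x => ih _ ?_ _ _ ?_ rfl
    · rw [Finset.sdiff_nonempty]
      refine fun h => hne (hR.antisymm fun y hy => ?_)
      exact (Finset.mem_union.1 (h (Finset.mem_univ y))).resolve_left (Finset.mem_sdiff.1 hy).2
    · rw [← hN, Finset.union_singleton, Finset.union_insert, Finset.sdiff_insert]
      exact Finset.card_erase_lt_of_mem x.2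
    · refine Finset.union_subset hR (Finset.singleton_subset_iff.2 ?_)
      exact Finset.sdiff_subset_sdiff subset_rfl Finset.subset_union_left x.2
  · exact hk A

end Execution

section Loops

variable {V : Type u} {f : Finset V → ℝ}

/-- The state of the first loop: `A` collects the elements of `R` that were accepted, in an order
of decreasing singleton values. An element rejected although it could be added for `M` is kept out
by a set `K` of accepted elements that are at least as valuable. -/
structure IsBait [DecidableEq V] (f : Finset V → ℝ) (M M' : Matroid V) (A R : Finset V) :
    Prop where
  subset : A ⊆ R
  indep : M.Indep (A : Set V)
  indep' : M'.Indep (A : Set V)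
  le : ∀ y ∈ A, ∀ x ∉ R, f {x} ≤ f {y}
  rejected : ∀ x ∈ R, x ∉ A → M.Indep (insert x A : Finset V) →
    ∃ K ⊆ A, ¬ M'.Indep (insert x K : Finset V) ∧ ∀ y ∈ K, f {x} ≤ f {y}

/-- `GreedyPath f N S T`: repeatedly adding to `S` an element of largest value among those that
keep the set independent in `N` leads to the set `T`, to which nothing can be added. -/
inductive GreedyPath [DecidableEq V] (f : Finset V → ℝ) (N : Matroid V) :
    Finset V → Finset V → Prop
  | refl (S : Finset V) (h : ∀ x ∉ S, ¬ N.Indep (insert x S : Finset V)) : GreedyPath f N S S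
  | step (S T : Finset V) (x : V) (hx : x ∉ S) (hind : N.Indep (insert x S : Finset V))
      (hmax : ∀ y ∉ S, N.Indep (insert y S : Finset V) → f (insert y S) ≤ f (insert x S))
      (h : GreedyPath f N (insert x S) T) : GreedyPath f N S T

variable [DecidableEq V] {β : Type v}

/-- Independence of `S` in the contraction of `A` is the feasibility test of the second loop. -/
theorem contract_indep_iff {M : Matroid V} {A S : Finset V} (hA : M.Indep (A : Set V)) :
    (M ／ (A : Set V)).Indep (S : Set V) ↔ Disjoint S A ∧ M.Indep (A ∪ S : Finset V) := by
  rw [hA.contract_indep_iff, Finset.disjoint_coe, Finset.coe_union, Set.union_comm]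

variable [Fintype V]

/-- The first loop ends with a bait set that has seen all elements. -/
theorem loop1_spec {M M' : Matroid V} {k : Finset V → Prog V β} {A R : Finset V} {b : β} {n : ℕ}
    (hA : IsBait f M M' A R) (h : Runs f (loop1 M M' k A R) b n) :
    ∃ A' c m, IsBait f M M' A' Finset.univ ∧ n = c + m ∧
      c ≤ (Finset.univ \ R).card * Fintype.card V ∧ Runs f (k A') b m := by
  induction hN : (Finset.univ \ R).card using Nat.strong_induction_on generalizing A R n with
  | _ N ih =>
  rw [loop1] at h
  split_ifs at h with hR
  · obtain ⟨⟨x, hx⟩, n', hmax, rfl, hrun'⟩ := runs_pickMax_iff.1 h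
    have hxR : x ∉ R := by simpa using hx
    have hmax' : ∀ y ∉ R, f {y} ≤ f {x} := fun y hy => hmax y (by simpa using hy)
    have hcard : (Finset.univ \ (R ∪ {x})).card + 1 = N := by
      rw [← hN, Finset.union_singleton, Finset.sdiff_insert]
      exact Finset.card_erase_add_one hx
    simp only [Finset.union_singleton] at hrun' hcard
    obtain ⟨B, key, hrun'⟩ : ∃ B, IsBait f M M' B (insert x R) ∧
        Runs f (loop1 M M' k B (insert x R)) b n' := by
      by_cases hind : M.Indep (A ∪ {x} : Finset V) ∧ M'.Indep (A ∪ {x} : Finset V)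
      · rw [if_pos hind] at hrun'
        refine ⟨_, ?_, hrun'⟩
        rw [Finset.union_singleton] at hind
        refine ⟨Finset.insert_subset_insert _ hA.subset, hind.1, hind.2, ?_, ?_⟩
        · intro y hy z hz
          rw [Finset.mem_insert, not_or] at hz
          rcases Finset.mem_insert.1 hy with rfl | hy
          · exact hmax' z hz.2
          · exact hA.le y hy z hz.2
        · intro z hz hzA hzind
          rw [Finset.mem_insert, not_or] at hzA
          obtain ⟨K, hK, h1, h2⟩ := hA.rejected z
            ((Finset.mem_insert.1 hz).resolve_left hzA.1) hzA.2
            (hzind.subset (by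
              exact_mod_cast Finset.insert_subset_insert z (Finset.subset_insert x A)))
          exact ⟨K, hK.trans (Finset.subset_insert _ _), h1, h2⟩
      · rw [if_neg hind] at hrun'
        rw [Finset.union_singleton] at hind
        refine ⟨_, ?_, hrun'⟩
        refine ⟨hA.subset.trans (Finset.subset_insert _ _), hA.indep, hA.indep', ?_, ?_⟩
        · intro y hy z hz
          rw [Finset.mem_insert, not_or] at hz
          exact hA.le y hy z hz.2
        · intro z hz hzA hzind
          rcases Finset.mem_insert.1 hz with rfl | hz
          · exact ⟨A, subset_rfl, fun h' => hind ⟨hzind, h'⟩, fun y hy => hA.le y hy z hxR⟩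
          · exact hA.rejected z hz hzA hzind
    obtain ⟨A', c, m, hA', rfl, hc, hrun⟩ := ih _ (by omega) key hrun' rfl
    refine ⟨A', c + (Finset.univ \ R).card, m, hA', by ring, ?_, hrun⟩
    have : (Finset.univ \ R).card ≤ Fintype.card V := Finset.card_le_univ _
    rw [← hcard, add_mul, one_mul]
    omega
  · rw [not_not] at hR
    subst hR
    exact ⟨A, 0, n, hA, by simp, by simp, h⟩

/-- The second loop follows a greedy path of the contraction of `A₁`: elements that it has rejected
stay infeasible, so its choice is the best among the feasible elements whenever it is feasible. -/
theorem loop2_spec {M : Matroid V} {A₁ : Finset V} (hA₁ : M.Indep (A₁ : Set V))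
    {k : Finset V → Prog V β} {S R : Finset V} {b : β} {n : ℕ}
    (hSR : S ⊆ R) (hR : Disjoint R A₁) (hS : (M ／ (A₁ : Set V)).Indep (S : Set V))
    (hrej : ∀ x ∈ R, x ∉ S → ¬ (M ／ (A₁ : Set V)).Indep (insert x S : Finset V))
    (h : Runs f (loop2 M A₁ k S R) b n) :
    ∃ T c m, GreedyPath f (M ／ (A₁ : Set V)) S T ∧ (M ／ (A₁ : Set V)).Indep (T : Set V) ∧
      n = c + m ∧ c ≤ (Finset.univ \ (A₁ ∪ R)).card * Fintype.card V ∧ Runs f (k T) b m := by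
  induction hN : (Finset.univ \ (A₁ ∪ R)).card using Nat.strong_induction_on
    generalizing S R n with
  | _ N ih =>
  rw [loop2] at h
  split_ifs at h with hne
  · obtain ⟨⟨x, hx⟩, n', hmax, rfl, hrun'⟩ := runs_pickMax_iff.1 h
    obtain ⟨hxA, hxR⟩ : x ∉ A₁ ∧ x ∉ R := by simpa using hx
    have hxS : x ∉ S := fun h => hxR (hSR h)
    have hcard : (Finset.univ \ (A₁ ∪ (R ∪ {x}))).card + 1 = N := by
      rw [← hN, Finset.union_singleton, Finset.union_insert, Finset.sdiff_insert]
      exact Finset.card_erase_add_one hx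
    have hdisj : Disjoint (insert x R) A₁ := Finset.disjoint_insert_left.2 ⟨hxA, hR⟩
    have hcost : (Finset.univ \ (A₁ ∪ R)).card ≤ Fintype.card V := Finset.card_le_univ _
    have hiff : M.Indep (A₁ ∪ S ∪ {x} : Finset V) ↔
        (M ／ (A₁ : Set V)).Indep (insert x S : Finset V) := by
      rw [contract_indep_iff hA₁, Finset.union_assoc, Finset.union_singleton]
      exact (and_iff_right (hdisj.mono_left (Finset.insert_subset_insert x hSR))).symm
    simp only [Finset.union_singleton] at hrun' hcard hmax
    by_cases hind : (M ／ (A₁ : Set V)).Indep (insert x S : Finset V)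
    · rw [if_pos (hiff.2 hind)] at hrun'
      obtain ⟨T, c, m, hT, hTi, rfl, hc, hrun⟩ :=
        ih _ (by omega) (Finset.insert_subset_insert x hSR) hdisj hind
          (by
            intro y hy hyS hyi
            rw [Finset.mem_insert, not_or] at hyS
            exact hrej y ((Finset.mem_insert.1 hy).resolve_left hyS.1) hyS.2
              (hyi.subset (by
                exact_mod_cast Finset.insert_subset_insert y (Finset.subset_insert x S)))) hrun' rfl
      refine ⟨T, c + (Finset.univ \ (A₁ ∪ R)).card, m, .step S T x hxS hind ?_ hT, hTi,
        by ring, ?_, hrun⟩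
      · intro y hy hyi
        have hyA : y ∉ A₁ :=
          (Finset.disjoint_insert_left.1 ((contract_indep_iff hA₁).1 hyi).1).1
        have hyR : y ∉ R := fun hyR => hrej y hyR hy hyi
        exact hmax y (by simp [hyA, hyR])
      · rw [← hcard, add_mul, one_mul]
        omega
    · rw [if_neg fun h' => hind (hiff.1 h')] at hrun'
      obtain ⟨T, c, m, hT, hTi, rfl, hc, hrun⟩ :=
        ih _ (by omega) (hSR.trans (Finset.subset_insert x R)) hdisj hS
          (by
            intro y hy hyS
            rcases Finset.mem_insert.1 hy with rfl | hy
            · exact hind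
            · exact hrej y hy hyS) hrun' rfl
      refine ⟨T, c + (Finset.univ \ (A₁ ∪ R)).card, m, hT, hTi, by ring, ?_, hrun⟩
      rw [← hcard, add_mul, one_mul]
      omega
  · rw [not_not] at hne
    refine ⟨S, 0, n, .refl S ?_, hS, by simp, by simp, h⟩
    intro x hx hxi
    have hxA : x ∉ A₁ := (Finset.disjoint_insert_left.1 ((contract_indep_iff hA₁).1 hxi).1).1
    exact hrej x (by simp [hne, hxA]) hx hxi

theorem exists_runs_algorithm (f : Finset V → ℝ) (M M' : Matroid V) :
    ∃ A n, Runs f (algorithm M M') A n :=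
  exists_runs_loop1 (fun A₁ => exists_runs_loop2 (fun A₂ => ⟨_, _, .ret _⟩) _ _ (by simp)) _ _

/-- Every execution uses at most `2 |V|²` evaluations and returns `A₁ ∪ A₂` for a bait set `A₁`
and a greedy set `A₂` of the contraction of `A₁`. -/
theorem algorithm_spec {M M' : Matroid V} {A : Finset V} {n : ℕ}
    (h : Runs f (algorithm M M') A n) :
    n ≤ 2 * Fintype.card V ^ 2 ∧ ∃ A₁ A₂ : Finset V, A = A₁ ∪ A₂ ∧
      IsBait f M M' A₁ Finset.univ ∧ GreedyPath f (M ／ (A₁ : Set V)) ∅ A₂ ∧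
      Disjoint A₂ A₁ ∧ M.Indep (A : Set V) := by
  obtain ⟨A₁, c, m, hA₁, rfl, hc, h⟩ :=
    loop1_spec ⟨subset_rfl, by simp, by simp, by simp, by simp⟩ h
  obtain ⟨A₂, c', m', hA₂, hi, rfl, hc', h⟩ :=
    loop2_spec hA₁.indep subset_rfl (by simp) (by simp) (by simp) h
  cases h
  rw [contract_indep_iff hA₁.indep] at hi
  refine ⟨?_, A₁, A₂, rfl, hA₁, hA₂, hi.1, hi.2⟩
  have h1 := hc.trans (Nat.mul_le_mul_right _ (Finset.card_le_univ _))
  have h2 := hc'.trans (Nat.mul_le_mul_right _ (Finset.card_le_univ _))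
  rw [pow_two]
  omega

end Loops

/-! ### Exchange arguments -/

section Exchange

variable {V : Type u} [DecidableEq V]

theorem exists_maximal_extension {M : Matroid V} {K : Finset V} (hK : M.Indep (K : Set V))
    (A : Finset V) :
    ∃ C ⊆ A \ K, M.Indep (K ∪ C : Finset V) ∧
      ∀ y ∈ A, y ∉ K ∪ C → ¬ M.Indep (insert y (K ∪ C) : Finset V) := by
  classical
  obtain ⟨C, hC, hmax⟩ :=
    ((A \ K).powerset.filter fun C => M.Indep (K ∪ C : Finset V)).exists_max_image
      Finset.card ⟨∅, by simpa using hK⟩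
  rw [Finset.mem_filter, Finset.mem_powerset] at hC
  refine ⟨C, hC.1, hC.2, fun y hy hyC hind => ?_⟩
  rw [Finset.mem_union, not_or] at hyC
  have := hmax (insert y C) (by
    rw [Finset.mem_filter, Finset.mem_powerset, Finset.union_insert]
    exact ⟨Finset.insert_subset (Finset.mem_sdiff.2 ⟨hy, hyC.1⟩) hC.1, hind⟩)
  rw [Finset.card_insert_of_notMem hyC.2] at this
  omega

/-- When `g` joins `S`, at most one element of a set `O` completing `S` has to leave. -/
theorem exists_indep_insert_erase {N : Matroid V} {S O : Finset V} {g : V}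
    (hSO : Disjoint O S) (hind : N.Indep (S ∪ O : Finset V)) (hgS : g ∉ S) (hgO : g ∉ O)
    (hg : N.Indep (insert g S : Finset V)) (hO : O.Nonempty) :
    ∃ o ∈ O, N.Indep (insert g S ∪ O.erase o : Finset V) := by
  obtain ⟨C, hC, hCind, hmax⟩ := exists_maximal_extension hg (S ∪ O)
  have hCO : C ⊆ O := fun y hy => by
    have := hC hy
    simp only [Finset.mem_sdiff, Finset.mem_union, Finset.mem_insert, not_or] at this
    exact this.1.resolve_left this.2.2
  have hcard : (S ∪ O).card ≤ (insert g S ∪ C).card := by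
    by_contra! hlt
    obtain ⟨e, he, he', hei⟩ := hCind.augment_finset hind hlt
    exact hmax e he he' (by exact_mod_cast hei)
  have hSC : Disjoint (insert g S) C := Finset.disjoint_insert_left.2
    ⟨fun h => hgO (hCO h), (hSO.mono_left hCO).symm⟩
  rw [Finset.card_union_of_disjoint hSO.symm, Finset.card_union_of_disjoint hSC,
    Finset.card_insert_of_notMem hgS] at hcard
  by_cases hCeq : C = O
  · obtain ⟨o, ho⟩ := hO
    refine ⟨o, ho, hCind.subset ?_⟩
    rw [hCeq]
    exact_mod_cast Finset.union_subset_union_right (Finset.erase_subset o O)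
  · obtain ⟨o, hoO, hoC⟩ := Finset.exists_of_ssubset (hCO.ssubset_of_ne hCeq)
    have hsub : C ⊆ O.erase o := Finset.subset_erase.2 ⟨hCO, hoC⟩
    have hceq : C = O.erase o := Finset.eq_of_subset_of_card_le hsub (by
      rw [Finset.card_erase_of_mem hoO]; omega)
    exact ⟨o, hoO, hceq ▸ hCind⟩

/-- In each class of `P`, an independent set that is maximal within its union with `Y` has at
least as many elements as the independent set `Y`. Every matroid has this property for a partition
into one class, and a partition matroid has it for its own partition. -/
def ClasswiseMaximal (M : Matroid V) {n : ℕ} (P : V → Fin n) : Prop :=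
  ∀ X Y : Finset V, M.Indep (X : Set V) → M.Indep (Y : Set V) →
    (∀ y ∈ Y, y ∉ X → ¬ M.Indep (insert y X : Finset V)) →
    ∀ i, (Y.filter (P · = i)).card ≤ (X.filter (P · = i)).card

/-- Both admissible cases are instances of one: `M'` is a partition matroid, with one class if it is
uniform, and `M` respects the classes. -/
theorem Admissible.exists_partition {M M' : Matroid V} (h : Admissible M M') :
    ∃ (n : ℕ) (P : V → Fin n) (b : Fin n → ℕ), ClasswiseMaximal M P ∧ IsPartitionWith M' P b := by
  rcases h with ⟨k, hk⟩ | ⟨n, P, a, b, ha, hb⟩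
  · refine ⟨1, fun _ => 0, fun _ => k, ?_, fun A => ?_⟩
    · intro X Y hX hY hmax i
      have hi : ∀ Z : Finset V, Z.filter (fun _ => (0 : Fin 1) = i) = Z := fun Z =>
        Finset.filter_true_of_mem fun _ _ => Subsingleton.elim _ _
      rw [hi, hi]
      by_contra! hlt
      obtain ⟨e, he, he', hei⟩ := hX.augment_finset hY hlt
      exact hmax e he he' (by exact_mod_cast hei)
    · simp [hk]
  · refine ⟨n, P, b, ?_, hb⟩
    intro X Y hX hY hmax i
    rw [ha] at hX hY
    by_cases hXY : Y.filter (P · = i) ⊆ X.filter (P · = i)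
    · exact Finset.card_le_card hXY
    obtain ⟨y, hyY, hyX⟩ := Finset.not_subset.1 hXY
    rw [Finset.mem_filter] at hyY hyX
    have hyX' : y ∉ X := fun h => hyX ⟨h, hyY.2⟩
    refine (hY i).trans ?_
    by_contra! hlt
    refine hmax y hyY.1 hyX' ((ha _).2 fun j => ?_)
    rw [Finset.filter_insert]
    split_ifs with hj
    · have hij : i = j := hyY.2.symm.trans hj
      subst hij
      exact (Finset.card_insert_le _ _).trans hlt
    · exact hX j

/-- For `K` independent in both matroids, the adversary can remove from any independent set `A` a
set that makes room for `K`. -/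
theorem exists_removal {M M' : Matroid V} (h : Admissible M M') {K A : Finset V}
    (hK : M.Indep (K : Set V)) (hK' : M'.Indep (K : Set V)) (hA : M.Indep (A : Set V)) :
    ∃ C ⊆ A, Disjoint C K ∧ M.Indep (K ∪ C : Finset V) ∧ M'.Indep (A \ C : Finset V) := by
  obtain ⟨n, P, b, hM, hM'⟩ := h.exists_partition
  obtain ⟨C, hC, hind, hmax⟩ := exists_maximal_extension hK A
  have hCA : C ⊆ A := hC.trans Finset.sdiff_subset
  have hCK : Disjoint C K := Finset.disjoint_of_subset_left hC Finset.sdiff_disjoint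
  refine ⟨C, hCA, hCK, hind, (hM' _).2 fun i => ?_⟩
  have h1 := hM _ _ hind hA hmax i
  have h2 := (hM' _).1 hK' i
  rw [Finset.filter_union, Finset.card_union_of_disjoint
    (Finset.disjoint_filter_filter hCK.symm)] at h1
  have h3 : ((A \ C).filter (P · = i)).card + (C.filter (P · = i)).card =
      (A.filter (P · = i)).card := by
    rw [← Finset.card_union_of_disjoint (Finset.disjoint_filter_filter Finset.sdiff_disjoint),
      ← Finset.filter_union, Finset.sdiff_union_of_subset hCA]
  omega

/-- The optimal value is at most the value of a set that can be added to the bait set. -/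
theorem exists_optValue_le [Fintype V] {M M' : Matroid V} (h : Admissible M M') (f : Finset V → ℝ)
    {K : Finset V} (hK : M.Indep (K : Set V)) (hK' : M'.Indep (K : Set V)) :
    ∃ O : Finset V, (M ／ (K : Set V)).Indep (O : Set V) ∧ optValue f M M' ≤ f O := by
  have : Nonempty {A : Finset V // M.Indep (A : Set V)} := ⟨⟨K, hK⟩⟩
  obtain ⟨⟨A, hA⟩, hAeq⟩ := exists_eq_ciSup_of_finite
    (f := fun A : {A : Finset V // M.Indep (A : Set V)} => worstValue f M' A.1)
  obtain ⟨C, hCA, hCK, hind, hrem⟩ := exists_removal h hK hK' hA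
  refine ⟨C, (contract_indep_iff hK).2 ⟨hCK, hind⟩, ?_⟩
  rw [optValue, ← hAeq]
  refine (ciInf_le (Set.finite_range _).bddBelow ⟨A \ C, Finset.sdiff_subset, hrem⟩).trans ?_
  simp [Finset.sdiff_sdiff_eq_self hCA]

end Exchange

/-! ### The bait set -/

section Bait

variable {V : Type u} [Fintype V] [DecidableEq V] {f : Finset V → ℝ} {M M' : Matroid V}

/-- The budget of the class of an element that can still be added to the bait set is exhausted by
bait elements that are at least as valuable. -/
theorem IsBait.class_full {n : ℕ} {P : V → Fin n} {b : Fin n → ℕ} {A₁ : Finset V}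
    (hM' : IsPartitionWith M' P b) (hA₁ : IsBait f M M' A₁ Finset.univ) {x : V} (hx : x ∉ A₁)
    (hind : M.Indep (insert x A₁ : Finset V)) :
    (A₁.filter (P · = P x)).card = b (P x) ∧ ∀ y ∈ A₁, P y = P x → f {x} ≤ f {y} := by
  obtain ⟨K, hKA, hKx, hle⟩ := hA₁.rejected x (Finset.mem_univ x) hx hind
  have hA := (hM' _).1 hA₁.indep'
  have hK := (hM' _).1 (hA₁.indep'.subset (by exact_mod_cast hKA : (K : Set V) ⊆ A₁))
  rw [hM'] at hKx
  push Not at hKx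
  obtain ⟨i, hi⟩ := hKx
  rw [Finset.filter_insert] at hi
  split_ifs at hi with hxi
  · subst hxi
    have hi' := hi.trans_le (Finset.card_insert_le _ _)
    have heq : K.filter (P · = P x) = A₁.filter (P · = P x) :=
      Finset.eq_of_subset_of_card_le (Finset.filter_subset_filter _ hKA)
        ((hA _).trans (by omega))
    refine ⟨le_antisymm (hA _) (by rw [← heq]; omega), fun y hy hyx => hle y ?_⟩
    have : y ∈ A₁.filter (P · = P x) := Finset.mem_filter.2 ⟨hy, hyx⟩
    rw [← heq] at this
    exact (Finset.mem_filter.1 this).1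
  · exact absurd (hK i) (by omega)

/-- In each class, an adversary that removes elements of `A₂` must leave as many elements of the
bait set, each at least as valuable. -/
theorem IsBait.card_removed_le {n : ℕ} {P : V → Fin n} {b : Fin n → ℕ} {A₁ A₂ B : Finset V}
    (hM' : IsPartitionWith M' P b) (hA₁ : IsBait f M M' A₁ Finset.univ)
    (hdisj : Disjoint A₂ A₁) (hA : M.Indep (A₁ ∪ A₂ : Finset V)) (hB : M'.Indep (B : Set V))
    {x : V} (hx : x ∈ A₂) :
    ((A₂ ∩ B).filter (P · = P x)).card ≤ ((A₁ \ B).filter (P · = P x)).card ∧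
      ∀ y ∈ A₁, P y = P x → f {x} ≤ f {y} := by
  obtain ⟨h1, h2⟩ := hA₁.class_full hM' (Finset.disjoint_left.1 hdisj hx)
    (hA.subset (by
      exact_mod_cast Finset.insert_subset (Finset.mem_union_right _ hx) Finset.subset_union_left))
  refine ⟨?_, h2⟩
  have h3 := (hM' _).1 hB (P x)
  have h4 : ((A₁ ∩ B).filter (P · = P x)).card + ((A₂ ∩ B).filter (P · = P x)).card ≤
      (B.filter (P · = P x)).card := by
    rw [← Finset.card_union_of_disjoint (Finset.disjoint_filter_filter
      (hdisj.symm.mono Finset.inter_subset_left Finset.inter_subset_left)), ← Finset.filter_union]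
    exact Finset.card_le_card (Finset.filter_subset_filter _
      (Finset.union_subset Finset.inter_subset_right Finset.inter_subset_right))
  have h5 : ((A₁ \ B).filter (P · = P x)).card + ((A₁ ∩ B).filter (P · = P x)).card =
      (A₁.filter (P · = P x)).card := by
    rw [← Finset.card_union_of_disjoint (Finset.disjoint_filter_filter
      (Finset.disjoint_sdiff_inter A₁ B)), ← Finset.filter_union, Finset.sdiff_union_inter]
  omega

theorem IsBait.sum_removed_le (h : Admissible M M') (hf : ∀ A, 0 ≤ f A) {A₁ A₂ B : Finset V}
    (hA₁ : IsBait f M M' A₁ Finset.univ) (hdisj : Disjoint A₂ A₁)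
    (hA : M.Indep (A₁ ∪ A₂ : Finset V)) (hB : M'.Indep (B : Set V)) :
    ∑ v ∈ A₂ ∩ B, f {v} ≤ ∑ v ∈ A₁ \ B, f {v} := by
  obtain ⟨n, P, b, -, hM'⟩ := h.exists_partition
  rw [← Finset.sum_fiberwise (A₂ ∩ B) P, ← Finset.sum_fiberwise (A₁ \ B) P]
  refine Finset.sum_le_sum fun i _ => ?_
  rcases ((A₂ ∩ B).filter (P · = i)).eq_empty_or_nonempty with he | hne
  · rw [he, Finset.sum_empty]
    exact Finset.sum_nonneg fun v _ => hf _
  · obtain ⟨x, hx, hmax⟩ := Finset.exists_max_image _ (fun v => f {v}) hne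
    rw [Finset.mem_filter, Finset.mem_inter] at hx
    obtain ⟨⟨hxA, -⟩, rfl⟩ := hx
    obtain ⟨hcard, hle⟩ := hA₁.card_removed_le hM' hdisj hA hB hxA
    calc _ ≤ ((A₂ ∩ B).filter (P · = P x)).card • f {x} := Finset.sum_le_card_nsmul _ _ _ hmax
      _ ≤ ((A₁ \ B).filter (P · = P x)).card • f {x} := nsmul_le_nsmul_left (hf _) hcard
      _ ≤ _ := Finset.card_nsmul_le_sum _ _ _ fun y hy => by
        rw [Finset.mem_filter, Finset.mem_sdiff] at hy
        exact hle y hy.1.1 hy.2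

theorem IsBait.exists_le_of_removed (h : Admissible M M') {A₁ A₂ B : Finset V}
    (hA₁ : IsBait f M M' A₁ Finset.univ) (hdisj : Disjoint A₂ A₁)
    (hA : M.Indep (A₁ ∪ A₂ : Finset V)) (hB : M'.Indep (B : Set V)) {x : V} (hx : x ∈ A₂)
    (hxB : x ∈ B) : ∃ y ∈ A₁ \ B, f {x} ≤ f {y} := by
  obtain ⟨n, P, b, -, hM'⟩ := h.exists_partition
  obtain ⟨hcard, hle⟩ := hA₁.card_removed_le hM' hdisj hA hB hx
  have : 0 < ((A₂ ∩ B).filter (P · = P x)).card := Finset.card_pos.2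
    ⟨x, Finset.mem_filter.2 ⟨Finset.mem_inter.2 ⟨hx, hxB⟩, rfl⟩⟩
  obtain ⟨y, hy⟩ := Finset.card_pos.1 (this.trans_le hcard)
  rw [Finset.mem_filter] at hy
  exact ⟨y, hy.1, hle y (Finset.mem_sdiff.1 hy.1).1 hy.2⟩

/-- Under `Budgeted`, the bait set is a basis of `M'` as soon as the algorithm adds anything to
it. -/
theorem IsBait.rank_le_card (h : Budgeted M M') {A₁ : Finset V} {β : ℕ} (hβ : M'.eRank = β)
    (hA₁ : IsBait f M M' A₁ Finset.univ) {x : V} (hx : x ∉ A₁)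
    (hxA : M.Indep (insert x A₁ : Finset V)) : β ≤ A₁.card := by
  obtain ⟨B₀, hB₀⟩ := M'.exists_isBase
  obtain ⟨B, rfl⟩ : ∃ B : Finset V, (B : Set V) = B₀ := ⟨B₀.toFinite.toFinset, by simp⟩
  have hcard : B.card = β := by
    have := hB₀.encard_eq_eRank
    rw [hβ, Set.encard_coe_eq_coe_finsetCard] at this
    exact_mod_cast this
  rw [← hcard]
  rcases h with ⟨k, hk⟩ | ⟨n, P, a, b, hab, ha, hb⟩
  · obtain ⟨K, hKA, hKx, -⟩ := hA₁.rejected x (Finset.mem_univ x) hx hxA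
    rw [hk, not_le] at hKx
    have h1 := (hk B).1 hB₀.indep
    have h2 := hKx.trans_le (Finset.card_insert_le _ _)
    have h3 := Finset.card_le_card hKA
    omega
  · rw [Finset.card_eq_sum_card_fiberwise (f := P) (s := B) (t := Finset.univ) (by simp),
      Finset.card_eq_sum_card_fiberwise (f := P) (s := A₁) (t := Finset.univ) (by simp)]
    refine Finset.sum_le_sum fun i _ => ?_
    rcases le_or_gt (b i) (A₁.filter (P · = i)).card with hle | hlt
    · exact ((hb B).1 hB₀.indep i).trans hle
    · refine Finset.card_le_card fun v hv => ?_
      rw [Finset.mem_filter] at hv ⊢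
      obtain ⟨-, rfl⟩ := hv
      refine ⟨?_, rfl⟩
      by_contra hvA
      refine hlt.ne (hA₁.class_full hb hvA ((ha _).2 fun j => ?_)).1
      rw [Finset.filter_insert]
      split_ifs with hj
      · subst hj
        exact (Finset.card_insert_le _ _).trans (Nat.succ_le_of_lt (hlt.trans_le (hab _)))
      · exact (ha _).1 hA₁.indep j

end Bait

/-! ### Marginal gains and curvature -/

section Marginals

variable {V : Type u} [DecidableEq V] {f : Finset V → ℝ}

theorem IsSubmodular.union_sub_le (hsub : IsSubmodular f) (S O : Finset V) {a : ℝ}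
    (h : ∀ o ∈ O, o ∉ S → f (insert o S) - f S ≤ a) :
    f (S ∪ O) - f S ≤ (O \ S).card * a := by
  induction O using Finset.induction_on with
  | empty => simp
  | insert o O ho ih =>
    have ih := ih fun y hy => h y (Finset.mem_insert_of_mem hy)
    by_cases hoS : o ∈ S
    · rwa [Finset.union_insert, Finset.insert_eq_of_mem (Finset.mem_union_left _ hoS),
        Finset.insert_sdiff_of_mem _ hoS]
    · have h1 := hsub S (S ∪ O) Finset.subset_union_left o
      have h2 := h o (Finset.mem_insert_self o O) hoS
      rw [Finset.union_insert, Finset.insert_sdiff_of_notMem _ hoS,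
        Finset.card_insert_of_notMem (fun h => ho (Finset.mem_sdiff.1 h).1)]
      push_cast
      linarith

theorem IsSubmodular.gain_le_singleton (hsub : IsSubmodular f) (h0 : f ∅ = 0) (S : Finset V)
    (v : V) : f (insert v S) - f S ≤ f {v} := by
  have := hsub ∅ S (Finset.empty_subset S) v
  rwa [h0, sub_zero, insert_empty_eq] at this

theorem IsSubmodular.le_sum (hsub : IsSubmodular f) (h0 : f ∅ = 0) (S T : Finset V) :
    f (S ∪ T) ≤ f S + ∑ v ∈ T, f {v} := by
  induction T using Finset.induction_on with
  | empty => simp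
  | insert v T hv ih =>
    rw [Finset.union_insert, Finset.sum_insert hv]
    linarith [hsub.gain_le_singleton h0 (S ∪ T) v]

/-- The marginal gains of `f` along an order of `S`. -/
theorem exists_sum_gain_eq (h0 : f ∅ = 0) (S : Finset V) :
    ∃ g : V → ℝ, ∑ v ∈ S, g v = f S ∧
      ∀ v ∈ S, ∃ X : Finset V, v ∉ X ∧ g v = f (insert v X) - f X := by
  induction S using Finset.induction_on with
  | empty => exact ⟨0, by simp [h0], by simp⟩
  | insert v S hv ih =>
    obtain ⟨g, hg, hgX⟩ := ih
    have hne : ∀ w ∈ S, w ≠ v := fun w hw h => hv (h ▸ hw)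
    refine ⟨Function.update g v (f (insert v S) - f S), ?_, fun w hw => ?_⟩
    · rw [Finset.sum_insert hv, Function.update_self,
        Finset.sum_congr rfl fun w hw => Function.update_of_ne (hne w hw) _ _, hg]
      ring
    · rcases Finset.mem_insert.1 hw with rfl | hw
      · exact ⟨S, hv, Function.update_self ..⟩
      · rw [Function.update_of_ne (hne w hw)]
        exact hgX w hw

/-- If every gain of `v` is at least `e f(v)`, then `f` is at least `e` times the sum of the
singleton values. -/
theorem mul_sum_le {e : ℝ} (h0 : f ∅ = 0)
    (he : ∀ v X, v ∉ X → e * f {v} ≤ f (insert v X) - f X) (S : Finset V) :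
    e * ∑ v ∈ S, f {v} ≤ f S := by
  obtain ⟨g, hg, hgX⟩ := exists_sum_gain_eq h0 S
  rw [← hg, Finset.mul_sum]
  refine Finset.sum_le_sum fun v hv => ?_
  obtain ⟨X, hvX, hX⟩ := hgX v hv
  rw [hX]
  exact he v X hvX

theorem totalCurvature_le_one (hmono : Monotone f) : totalCurvature f ≤ 1 := by
  rw [totalCurvature, sub_le_self_iff]
  refine Real.sInf_nonneg ?_
  rintro r ⟨v, A, B, -, -, -, rfl⟩
  exact div_nonneg (sub_nonneg.2 (hmono (Finset.subset_insert _ _)))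
    (sub_nonneg.2 (hmono (Finset.subset_insert _ _)))

theorem one_sub_totalCurvature_mul_le (hmono : Monotone f) {v : V} {X Y : Finset V} (hX : v ∉ X)
    (hY : v ∉ Y) :
    (1 - totalCurvature f) * (f (insert v Y) - f Y) ≤ f (insert v X) - f X := by
  have hgain : ∀ (v : V) (Z : Finset V), 0 ≤ f (insert v Z) - f Z := fun v Z =>
    sub_nonneg.2 (hmono (Finset.subset_insert v Z))
  by_cases hfv : f (insert v Y) - f Y = 0
  · rw [hfv, mul_zero]
    exact hgain v X
  · rw [← le_div_iff₀ ((hgain v Y).lt_of_ne' hfv), totalCurvature, sub_sub_cancel]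
    refine csInf_le ⟨0, ?_⟩ ⟨v, X, Y, hX, hY, hfv, rfl⟩
    rintro r ⟨v, A, B, -, -, -, rfl⟩
    exact div_nonneg (hgain _ _) (hgain _ _)

variable [Fintype V]

theorem curvature_le_one (hmono : Monotone f) (hf : ∀ A, 0 ≤ f A) : curvature f ≤ 1 := by
  rw [curvature, sub_le_self_iff]
  refine Real.sInf_nonneg ?_
  rintro r ⟨v, -, rfl⟩
  exact div_nonneg (sub_nonneg.2 (hmono (Finset.erase_subset _ _))) (hf _)

theorem one_sub_curvature_mul_le (hmono : Monotone f) (hf : ∀ A, 0 ≤ f A) (hsub : IsSubmodular f)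
    {v : V} {X : Finset V} (hv : v ∉ X) :
    (1 - curvature f) * f {v} ≤ f (insert v X) - f X := by
  by_cases hfv : f {v} = 0
  · rw [hfv, mul_zero]
    exact sub_nonneg.2 (hmono (Finset.subset_insert v X))
  · have h1 : 1 - curvature f ≤ (f Finset.univ - f (Finset.univ.erase v)) / f {v} := by
      rw [curvature, sub_sub_cancel]
      refine csInf_le ⟨0, ?_⟩ ⟨v, hfv, rfl⟩
      rintro r ⟨v, -, rfl⟩
      exact div_nonneg (sub_nonneg.2 (hmono (Finset.erase_subset _ _))) (hf _)
    have h2 := hsub X (Finset.univ.erase v)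
      (Finset.subset_erase.2 ⟨Finset.subset_univ X, hv⟩) v
    rw [Finset.insert_erase (Finset.mem_univ v)] at h2
    exact ((le_div_iff₀ ((hf _).lt_of_ne' hfv)).1 h1).trans h2

theorem curvature_nonneg (hmono : Monotone f) (hf : ∀ A, 0 ≤ f A) (hsub : IsSubmodular f)
    (h0 : f ∅ = 0) : 0 ≤ curvature f := by
  by_cases h : ∃ v, f {v} ≠ 0
  · obtain ⟨v, hv⟩ := h
    have h1 := one_sub_curvature_mul_le hmono hf hsub (Finset.notMem_empty v)
    rw [h0, sub_zero, insert_empty_eq] at h1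
    have := le_of_mul_le_mul_right (h1.trans_eq (one_mul _).symm) ((hf _).lt_of_ne' hv)
    linarith
  · -- the infimum of the empty set is `0`
    push Not at h
    simp [curvature, h]

end Marginals

/-! ### Greedy sets -/

section Greedy

variable {V : Type u} [DecidableEq V] {f : Finset V → ℝ} {N : Matroid V}

theorem eq_empty_of_forall_not_indep_insert {S O : Finset V} (hSO : Disjoint O S)
    (hind : N.Indep (S ∪ O : Finset V)) (h : ∀ x ∉ S, ¬ N.Indep (insert x S : Finset V)) :
    O = ∅ := by
  refine Finset.eq_empty_of_forall_notMem fun o ho => h o (Finset.disjoint_left.1 hSO ho) ?_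
  exact hind.subset (by
    exact_mod_cast Finset.insert_subset (Finset.mem_union_right _ ho) Finset.subset_union_left)

/-- Induction along a greedy path, with a set `O` that completes the current set `S`. Each greedy
element `g` either belongs to `O`, or replaces an element `o` of `O` that was also available, and
so did not have a larger gain. -/
theorem GreedyPath.induction_completion (hmono : Monotone f)
    {Q : Finset V → Finset V → Finset V → Prop}
    (empty : ∀ S T, f S ≤ f T → Q S T ∅)
    (mem : ∀ S T O g, g ∉ S → g ∈ O → Q (insert g S) T (O.erase g) → Q S T O)
    (swap : ∀ S T O g o, g ∉ S → g ∉ O → o ∈ O → Disjoint O S → f (insert o S) ≤ f (insert g S) →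
      Q (insert g S) T (O.erase o) → Q S T O)
    {S T : Finset V} (h : GreedyPath f N S T) {O : Finset V} (hSO : Disjoint O S)
    (hO : N.Indep (S ∪ O : Finset V)) : Q S T O := by
  have hle : ∀ {S T : Finset V}, GreedyPath f N S T → f S ≤ f T := by
    intro S T h
    induction h with
    | refl S h => exact le_rfl
    | step S T g hg hgi hmax h ih => exact (hmono (Finset.subset_insert g S)).trans ih
  induction h generalizing O with
  | refl S h =>
    obtain rfl := eq_empty_of_forall_not_indep_insert hSO hO h
    exact empty S S le_rfl
  | step S T g hg hgi hmax h ih =>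
    by_cases hgO : g ∈ O
    · refine mem S T O g hg hgO (ih ?_ ?_)
      · rw [Finset.disjoint_insert_right]
        exact ⟨Finset.notMem_erase g O, hSO.mono_left (Finset.erase_subset g O)⟩
      · rwa [Finset.insert_union, ← Finset.union_insert, Finset.insert_erase hgO]
    · rcases O.eq_empty_or_nonempty with rfl | hne
      · exact empty S T ((hmono (Finset.subset_insert g S)).trans (hle h))
      · obtain ⟨o, ho, hoi⟩ := exists_indep_insert_erase hSO hO hg hgO hgi hne
        have hoS : o ∉ S := Finset.disjoint_left.1 hSO ho
        refine swap S T O g o hg hgO ho hSO (hmax o hoS (hO.subset ?_)) (ih ?_ hoi)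
        · exact_mod_cast Finset.insert_subset (Finset.mem_union_right _ ho)
            Finset.subset_union_left
        · rw [Finset.disjoint_insert_right]
          exact ⟨fun h => hgO (Finset.mem_of_mem_erase h),
            hSO.mono_left (Finset.erase_subset o O)⟩

/-- The greedy guarantee for a matroid and a submodular function of curvature `κ`. -/
theorem GreedyPath.submodular_bound (hmono : Monotone f) (hsub : IsSubmodular f) (h0 : f ∅ = 0)
    {κ : ℝ} (hκ0 : 0 ≤ κ) (hκ1 : κ ≤ 1)
    (hκ : ∀ v X, v ∉ X → (1 - κ) * f {v} ≤ f (insert v X) - f X)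
    {S T : Finset V} (h : GreedyPath f N S T) {O : Finset V} (hSO : Disjoint O S)
    (hO : N.Indep (S ∪ O : Finset V)) :
    f (S ∪ O) - f S ≤ (1 + κ) * (f T - f S) := by
  refine GreedyPath.induction_completion
    (Q := fun S T O => f (S ∪ O) - f S ≤ (1 + κ) * (f T - f S)) hmono ?_ ?_ ?_ h hSO hO
  · intro S T hST
    rw [Finset.union_empty, sub_self]
    exact mul_nonneg (by linarith) (sub_nonneg.2 hST)
  · intro S T O g _ hg ih
    rw [Finset.insert_union, ← Finset.union_insert, Finset.insert_erase hg] at ih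
    nlinarith [hmono (Finset.subset_insert g S)]
  · intro S T O g o hgS hgO ho _ hle ih
    have h1 := hsub S (S ∪ O.erase o) Finset.subset_union_left o
    rw [← Finset.union_insert, Finset.insert_erase ho] at h1
    have h2 := hκ g (S ∪ O.erase o) (by
      rw [Finset.mem_union, not_or]
      exact ⟨hgS, fun h => hgO (Finset.mem_of_mem_erase h)⟩)
    have h3 := mul_le_mul_of_nonneg_left (hsub.gain_le_singleton h0 S g) (sub_nonneg.2 hκ1)
    rw [Finset.insert_union] at ih
    linarith

/-- The greedy guarantee for a matroid and a function whose gains at `v` are all at least `m v`. -/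
theorem GreedyPath.sum_le (hmono : Monotone f) {m : V → ℝ}
    {S T : Finset V} (h : GreedyPath f N S T) {O : Finset V}
    (hm : ∀ v ∈ O, ∀ X, v ∉ X → m v ≤ f (insert v X) - f X) (hSO : Disjoint O S)
    (hO : N.Indep (S ∪ O : Finset V)) :
    ∑ v ∈ O, m v ≤ f T - f S := by
  refine GreedyPath.induction_completion
    (Q := fun S T O => (∀ v ∈ O, ∀ X, v ∉ X → m v ≤ f (insert v X) - f X) →
      ∑ v ∈ O, m v ≤ f T - f S) hmono ?_ ?_ ?_ h hSO hO hm
  · intro S T hST _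
    simpa using hST
  · intro S T O g hgS hg ih hm
    have := ih fun v hv => hm v (Finset.mem_of_mem_erase hv)
    rw [← Finset.add_sum_erase O m hg]
    linarith [hm g hg S hgS]
  · intro S T O g o _ _ ho hSO hle ih hm
    have := ih fun v hv => hm v (Finset.mem_of_mem_erase hv)
    rw [← Finset.add_sum_erase O m ho]
    linarith [hm o ho S (Finset.disjoint_left.1 hSO ho)]

/-- One greedy step outside of `O`: `X` is the value of `O` still missing, `a` the greedy gain. -/
theorem exp_step {κ X a m t : ℝ} (hm : 0 < m) (hX : X ≤ m * a) (hX0 : 0 ≤ X) (hκ : 0 ≤ κ) :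
    X * (1 - Real.exp (-(κ * (t / m)))) ≤
      κ * a + (X - κ * a) * (1 - Real.exp (-(κ * ((t - 1) / m)))) := by
  set E := Real.exp (-(κ * ((t - 1) / m))) with hE
  have h1 : Real.exp (-(κ * (t / m))) = E * Real.exp (-(κ / m)) := by
    rw [hE, ← Real.exp_add]
    congr 1
    field_simp
    ring
  have h2 : 1 - κ / m ≤ Real.exp (-(κ / m)) := by
    linarith [Real.add_one_le_exp (-(κ / m))]
  have hE0 : 0 < E := Real.exp_pos _
  have h3 : X / m ≤ a := by rwa [div_le_iff₀' hm]
  have h4 : X * (E * (1 - κ / m)) ≤ X * (E * Real.exp (-(κ / m))) := by gcongr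
  have h5 : κ * E * (X / m) ≤ κ * E * a := by gcongr
  rw [h1]
  have h6 : X * (E * (1 - κ / m)) = X * E - κ * E * (X / m) := by ring
  linarith

/-- One greedy step inside `O`. -/
theorem exp_step_mem {κ X a m t : ℝ} (hm : 1 ≤ m) (ht : 1 ≤ t) (htm : t ≤ m) (hX : X ≤ m * a)
    (hX0 : 0 ≤ X) (hκ : 0 ≤ κ) (hκ1 : κ ≤ 1) :
    X * (1 - Real.exp (-(κ * (t / m)))) ≤
      κ * a + (X - a) * (1 - Real.exp (-(κ * ((t - 1) / (m - 1))))) := by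
  set w := (t - 1) / (m - 1) with hw
  have hw0 : 0 ≤ w := div_nonneg (by linarith) (by linarith)
  have hw1 : w ≤ 1 := div_le_one_of_le₀ (by linarith) (by linarith)
  -- also for `m = 1`, where `w = 0 / 0 = 0`
  have hsplit : t / m = w + (1 - w) / m := by
    rcases hm.eq_or_lt with rfl | hm'
    · have : t = 1 := le_antisymm htm ht
      simp [hw, this]
    · have : m - 1 ≠ 0 := by linarith
      have : m ≠ 0 := by linarith
      rw [hw]
      field_simp
      ring
  set E := Real.exp (-(κ * w)) with hE
  have hE0 : 0 < E := Real.exp_pos _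
  have h1 : Real.exp (-(κ * (t / m))) = E * Real.exp (-(κ * (1 - w) / m)) := by
    rw [hE, ← Real.exp_add, hsplit]
    congr 1
    ring
  have h2 : 1 - κ * (1 - w) / m ≤ Real.exp (-(κ * (1 - w) / m)) := by
    linarith [Real.add_one_le_exp (-(κ * (1 - w) / m))]
  have h3 : 1 - κ * w ≤ E := by
    linarith [Real.add_one_le_exp (-(κ * w))]
  have hm0 : 0 < m := by linarith
  have h4 : X / m ≤ a := by rwa [div_le_iff₀' hm0]
  have h5 : X * (E * (1 - κ * (1 - w) / m)) ≤ X * (E * Real.exp (-(κ * (1 - w) / m))) := by gcongr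
  have hκw : κ * w ≤ κ := mul_le_of_le_one_right hκ hw1
  have h6 : (κ - 1 + E) * (X / m) ≤ (κ - 1 + E) * a :=
    mul_le_mul_of_nonneg_left h4 (by linarith)
  have h7 : 1 - κ ≤ E * (1 - κ * (1 - w)) := by
    have : (1 - κ * w) * (1 - κ * (1 - w)) ≤ E * (1 - κ * (1 - w)) :=
      mul_le_mul_of_nonneg_right h3 (by nlinarith)
    nlinarith [mul_nonneg (mul_nonneg hκ hκ) (mul_nonneg hw0 (sub_nonneg.2 hw1))]
  have h8 : (1 - κ) * (X / m) ≤ E * (1 - κ * (1 - w)) * (X / m) :=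
    mul_le_mul_of_nonneg_right h7 (by positivity)
  have h9 : X * (E * (1 - κ * (1 - w) / m)) = X * E - E * (κ * (1 - w)) * (X / m) := by ring
  rw [h1]
  linarith

/-- The greedy guarantee for a uniform constraint and a submodular function of curvature `κ`: `t`
elements are still to be chosen, and `O` has at most `m` elements outside of `S`. -/
theorem GreedyPath.uniform_bound (hmono : Monotone f) (hsub : IsSubmodular f) (h0 : f ∅ = 0)
    {κ : ℝ} (hκ0 : 0 ≤ κ) (hκ1 : κ ≤ 1)
    (hκ : ∀ v X, v ∉ X → (1 - κ) * f {v} ≤ f (insert v X) - f X)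
    {U : Finset V} {p : ℕ} (hN : ∀ X : Finset V, N.Indep (X : Set V) ↔ Disjoint X U ∧ X.card ≤ p)
    {S T : Finset V} (h : GreedyPath f N S T) (hS : Disjoint S U) {O : Finset V} {t m : ℕ}
    (hO : Disjoint O U) (hcard : (O \ S).card ≤ m) (ht : S.card + t = p) (htm : t ≤ m) :
    (f (S ∪ O) - f S) * (1 - Real.exp (-(κ * (t / m)))) ≤ κ * (f T - f S) := by
  induction h generalizing t m with
  | refl S h =>
    rcases Nat.eq_zero_or_pos t with rfl | htpos
    · simp
    · have : O ⊆ S := by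
        intro o ho
        by_contra hoS
        refine h o hoS ((hN _).2 ⟨?_, ?_⟩)
        · exact Finset.disjoint_insert_left.2 ⟨Finset.disjoint_left.1 hO ho, hS⟩
        · rw [Finset.card_insert_of_notMem hoS]
          omega
      rw [Finset.union_eq_left.2 this]
      simp
  | step S T g hg hgi hmax h ih =>
    obtain ⟨hgU, hgp⟩ := (hN _).1 hgi
    have hcS := Finset.card_insert_of_notMem hg
    have htpos : 1 ≤ t := by omega
    have ht1 : ((t - 1 : ℕ) : ℝ) = (t : ℝ) - 1 := by push_cast [htpos]; ring
    have hm1 : ((m - 1 : ℕ) : ℝ) = (m : ℝ) - 1 := by push_cast [htpos.trans htm]; ring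
    have htR : (1 : ℝ) ≤ t := by exact_mod_cast htpos
    have htmR : (t : ℝ) ≤ m := by exact_mod_cast htm
    have hX0 : 0 ≤ f (S ∪ O) - f S := sub_nonneg.2 (hmono Finset.subset_union_left)
    have ha0 : 0 ≤ f (insert g S) - f S := sub_nonneg.2 (hmono (Finset.subset_insert g S))
    have hX : f (S ∪ O) - f S ≤ m * (f (insert g S) - f S) := by
      refine (hsub.union_sub_le S O (a := f (insert g S) - f S) fun o ho hoS => ?_).trans
        (mul_le_mul_of_nonneg_right (by exact_mod_cast hcard) ha0)
      refine sub_le_sub_right (hmax o hoS ((hN _).2 ⟨?_, ?_⟩)) _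
      · exact Finset.disjoint_insert_left.2 ⟨Finset.disjoint_left.1 hO ho, hS⟩
      · rwa [Finset.card_insert_of_notMem hoS, ← hcS]
    by_cases hgO : g ∈ O
    · have hc : (O \ insert g S).card ≤ m - 1 := by
        rw [Finset.sdiff_insert, Finset.card_erase_of_mem (Finset.mem_sdiff.2 ⟨hgO, hg⟩)]
        omega
      have := ih hgU hc (t := t - 1) (by omega) (by omega)
      rw [Finset.insert_union, Finset.insert_eq_of_mem (Finset.mem_union_right S hgO), ht1,
        hm1] at this
      have h2 := exp_step_mem (htR.trans htmR) htR htmR hX hX0 hκ0 hκ1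
      linarith
    · have hc : (O \ insert g S).card ≤ m :=
        (Finset.card_le_card (Finset.sdiff_subset_sdiff subset_rfl
          (Finset.subset_insert g S))).trans hcard
      have := ih hgU hc (t := t - 1) (by omega) (by omega)
      rw [Finset.insert_union, ht1] at this
      have h2 := exp_step (t := t) (by linarith : (0 : ℝ) < m) hX hX0 hκ0
      have h3 := hκ g (S ∪ O) (by simp [hg, hgO])
      have h4 := mul_le_mul_of_nonneg_left (hsub.gain_le_singleton h0 S g) (sub_nonneg.2 hκ1)
      have h5 : 0 ≤ 1 - Real.exp (-(κ * (((t : ℝ) - 1) / m))) := by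
        rw [sub_nonneg, Real.exp_le_one_iff, neg_nonpos]
        exact mul_nonneg hκ0 (div_nonneg (by linarith) (by linarith))
      have h6 : (f (S ∪ O) - f S - κ * (f (insert g S) - f S)) *
          (1 - Real.exp (-(κ * (((t : ℝ) - 1) / m)))) ≤
          (f (insert g (S ∪ O)) - f (insert g S)) *
          (1 - Real.exp (-(κ * (((t : ℝ) - 1) / m)))) :=
        mul_le_mul_of_nonneg_right (by linarith) h5
      linarith

end Greedy

/-! ### The value after a removal -/

section Removal

variable {V : Type u} [Fintype V] [DecidableEq V] {f : Finset V → ℝ} {M M' : Matroid V}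
  {A₁ A₂ B : Finset V}

theorem IsBait.sum_le_sum_sdiff (h : Admissible M M') (hf : ∀ A, 0 ≤ f A)
    (hA₁ : IsBait f M M' A₁ Finset.univ) (hdisj : Disjoint A₂ A₁)
    (hA : M.Indep (A₁ ∪ A₂ : Finset V)) (hB : M'.Indep (B : Set V)) :
    ∑ v ∈ A₂, f {v} ≤ ∑ v ∈ (A₁ ∪ A₂) \ B, f {v} := by
  rw [Finset.union_sdiff_distrib, Finset.sum_union (hdisj.symm.mono Finset.sdiff_subset
    Finset.sdiff_subset), ← Finset.sum_inter_add_sum_sdiff A₂ B]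
  exact add_le_add_left (hA₁.sum_removed_le h hf hdisj hA hB) _

/-- Either nothing of the greedy set is removed, or a bait element survives that is at least as
valuable as each removed one. -/
theorem IsBait.le_one_add_rank_mul (h : Admissible M M') (hmono : Monotone f)
    (hsub : IsSubmodular f) (h0 : f ∅ = 0) (hf : ∀ A, 0 ≤ f A) {β : ℕ} (hβ : M'.eRank = β)
    (hA₁ : IsBait f M M' A₁ Finset.univ) (hdisj : Disjoint A₂ A₁)
    (hA : M.Indep (A₁ ∪ A₂ : Finset V)) (hB : M'.Indep (B : Set V)) :
    f A₂ ≤ (1 + β) * f ((A₁ ∪ A₂) \ B) := by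
  have hBβ : B.card ≤ β := by
    have := hB.encard_le_eRank
    rw [hβ, Set.encard_coe_eq_coe_finsetCard] at this
    exact_mod_cast this
  have h1 := hsub.le_sum h0 (A₂ \ B) (A₂ ∩ B)
  rw [Finset.sdiff_union_inter] at h1
  have h2 : f (A₂ \ B) ≤ f ((A₁ ∪ A₂) \ B) :=
    hmono (Finset.sdiff_subset_sdiff Finset.subset_union_right subset_rfl)
  have h3 : ∑ v ∈ A₂ ∩ B, f {v} ≤ (A₂ ∩ B).card • f ((A₁ ∪ A₂) \ B) := by
    refine Finset.sum_le_card_nsmul _ _ _ fun v hv => ?_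
    rw [Finset.mem_inter] at hv
    obtain ⟨w, hw, hvw⟩ := hA₁.exists_le_of_removed h hdisj hA hB hv.1 hv.2
    refine hvw.trans (hmono (Finset.singleton_subset_iff.2 ?_))
    exact Finset.sdiff_subset_sdiff Finset.subset_union_left subset_rfl hw
  have h4 : ((A₂ ∩ B).card : ℝ) ≤ β := by
    exact_mod_cast (Finset.card_le_card Finset.inter_subset_right).trans hBβ
  have h5 := mul_le_mul_of_nonneg_right h4 (hf ((A₁ ∪ A₂) \ B))
  rw [nsmul_eq_mul] at h3
  linarith

/-- Every greedy element is worth at most the value that survives, and under `Budgeted` there are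
at most `α - β` greedy elements. -/
theorem IsBait.one_div_rank_sub_mul_le (h : Admissible M M') (hbud : Budgeted M M')
    (hmono : Monotone f) (hsub : IsSubmodular f) (h0 : f ∅ = 0) (hf : ∀ A, 0 ≤ f A) {α β : ℕ}
    (hα : M.eRank = α) (hβ : M'.eRank = β)
    (hA₁ : IsBait f M M' A₁ Finset.univ) (hdisj : Disjoint A₂ A₁)
    (hA : M.Indep (A₁ ∪ A₂ : Finset V)) (hB : M'.Indep (B : Set V)) :
    1 / ((α : ℝ) - β) * f A₂ ≤ f ((A₁ ∪ A₂) \ B) := by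
  rcases A₂.eq_empty_or_nonempty with rfl | ⟨x, hx⟩
  · rw [h0, mul_zero]
    exact hf _
  have h1 : β ≤ A₁.card := hA₁.rank_le_card hbud hβ (Finset.disjoint_left.1 hdisj hx)
    (hA.subset (by
      exact_mod_cast Finset.insert_subset (Finset.mem_union_right _ hx) Finset.subset_union_left))
  have h2 : A₁.card + A₂.card ≤ α := by
    have := hA.encard_le_eRank
    rw [hα, Set.encard_coe_eq_coe_finsetCard, Finset.card_union_of_disjoint hdisj.symm] at this
    exact_mod_cast this
  have h3 : ∑ v ∈ A₂, f {v} ≤ A₂.card • f ((A₁ ∪ A₂) \ B) := by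
    refine Finset.sum_le_card_nsmul _ _ _ fun v hv => ?_
    by_cases hvB : v ∈ B
    · obtain ⟨w, hw, hvw⟩ := hA₁.exists_le_of_removed h hdisj hA hB hv hvB
      refine hvw.trans (hmono (Finset.singleton_subset_iff.2 ?_))
      exact Finset.sdiff_subset_sdiff Finset.subset_union_left subset_rfl hw
    · exact hmono (Finset.singleton_subset_iff.2
        (Finset.mem_sdiff.2 ⟨Finset.mem_union_right _ hv, hvB⟩))
  have h4 := hsub.le_sum h0 ∅ A₂
  rw [Finset.empty_union, h0, zero_add] at h4
  have h5 : (β : ℝ) + A₂.card ≤ α := by exact_mod_cast (Nat.add_le_add_right h1 _).trans h2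
  have h6 : (1 : ℝ) ≤ A₂.card := by exact_mod_cast Finset.card_pos.2 ⟨x, hx⟩
  have h7 := mul_le_mul_of_nonneg_right (by linarith : (A₂.card : ℝ) ≤ α - β)
    (hf ((A₁ ∪ A₂) \ B))
  rw [nsmul_eq_mul] at h3
  rw [one_div_mul_eq_div, div_le_iff₀' (by linarith)]
  linarith

end Removal

/-! ### The value of the greedy set -/

section GreedySet

variable {V : Type u} [Fintype V] [DecidableEq V] {f : Finset V → ℝ} {M M' : Matroid V}
  {A₁ A₂ : Finset V}

theorem GreedyPath.optValue_le (h : Admissible M M') (hmono : Monotone f) (hsub : IsSubmodular f)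
    (h0 : f ∅ = 0) (hf : ∀ A, 0 ≤ f A) (hA₁ : M.Indep (A₁ : Set V)) (hA₁' : M'.Indep (A₁ : Set V))
    (hA₂ : GreedyPath f (M ／ (A₁ : Set V)) ∅ A₂) :
    1 / (1 + curvature f) * optValue f M M' ≤ f A₂ := by
  obtain ⟨O, hO, hle⟩ := exists_optValue_le h f hA₁ hA₁'
  have hκ0 := curvature_nonneg hmono hf hsub h0
  have := hA₂.submodular_bound hmono hsub h0 hκ0 (curvature_le_one hmono hf)
    (fun v X hv => one_sub_curvature_mul_le hmono hf hsub hv) (Finset.disjoint_empty_right O)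
    (by simpa using hO)
  rw [Finset.empty_union, h0, sub_zero, sub_zero] at this
  rw [one_div_mul_eq_div, div_le_iff₀' (by linarith)]
  exact hle.trans this

theorem GreedyPath.expRatio_mul_optValue_le (h : Admissible M M') (hM : IsUniform M)
    (hmono : Monotone f) (hsub : IsSubmodular f) (h0 : f ∅ = 0) (hf : ∀ A, 0 ≤ f A)
    (hA₁ : M.Indep (A₁ : Set V)) (hA₁' : M'.Indep (A₁ : Set V))
    (hA₂ : GreedyPath f (M ／ (A₁ : Set V)) ∅ A₂) :
    expRatio (curvature f) * optValue f M M' ≤ f A₂ := by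
  have hκ0 := curvature_nonneg hmono hf hsub h0
  rw [expRatio]
  split_ifs with hκ
  · -- without curvature the bound for general matroids is already tight
    simpa [hκ] using hA₂.optValue_le h hmono hsub h0 hf hA₁ hA₁'
  obtain ⟨O, hO, hle⟩ := exists_optValue_le h f hA₁ hA₁'
  obtain ⟨k, hk⟩ := hM
  have hA₁k := (hk _).1 hA₁
  have hN : ∀ X : Finset V, (M ／ (A₁ : Set V)).Indep (X : Set V) ↔
      Disjoint X A₁ ∧ X.card ≤ k - A₁.card := by
    intro X
    rw [contract_indep_iff hA₁, hk]
    refine and_congr_right fun hX => ?_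
    rw [Finset.card_union_of_disjoint hX.symm]
    omega
  obtain ⟨hOd, hOc⟩ := (hN O).1 hO
  have hexp : 0 ≤ 1 - Real.exp (-curvature f) := by
    rw [sub_nonneg, Real.exp_le_one_iff, neg_nonpos]
    exact hκ0
  rw [div_mul_eq_mul_div, div_le_iff₀ (hκ0.lt_of_ne' hκ), mul_comm, mul_comm (f A₂)]
  refine (mul_le_mul_of_nonneg_right hle hexp).trans ?_
  rcases Nat.eq_zero_or_pos (k - A₁.card) with hp | hp
  · rw [hp, Nat.le_zero, Finset.card_eq_zero] at hOc
    rw [hOc, h0, zero_mul]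
    exact mul_nonneg hκ0 (hf _)
  · have := hA₂.uniform_bound hmono hsub h0 hκ0 (curvature_le_one hmono hf)
      (fun v X hv => one_sub_curvature_mul_le hmono hf hsub hv) hN (Finset.disjoint_empty_left _)
      hOd (m := k - A₁.card) (t := k - A₁.card) (by simpa using hOc) (by simp) le_rfl
    rwa [div_self (by exact_mod_cast hp.ne'), mul_one, Finset.empty_union, h0, sub_zero,
      sub_zero] at this

theorem GreedyPath.totalCurvature_mul_optValue_le (h : Admissible M M') (hmono : Monotone f)
    (h0 : f ∅ = 0) (hA₁ : M.Indep (A₁ : Set V)) (hA₁' : M'.Indep (A₁ : Set V))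
    (hA₂ : GreedyPath f (M ／ (A₁ : Set V)) ∅ A₂) :
    (1 - totalCurvature f) * optValue f M M' ≤ f A₂ := by
  obtain ⟨O, hO, hle⟩ := exists_optValue_le h f hA₁ hA₁'
  obtain ⟨g, hg, hgX⟩ := exists_sum_gain_eq h0 O
  have := hA₂.sum_le hmono (O := O) (m := fun v => (1 - totalCurvature f) * g v)
    (fun v hv X hX => by
      obtain ⟨Y, hY, hgv⟩ := hgX v hv
      rw [hgv]
      exact one_sub_totalCurvature_mul_le hmono hX hY)
    (Finset.disjoint_empty_right O) (by simpa using hO)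
  rw [← Finset.mul_sum, hg, h0, sub_zero] at this
  exact (mul_le_mul_of_nonneg_left hle (sub_nonneg.2 (totalCurvature_le_one hmono))).trans this

end GreedySet

theorem mul_le_div_of_mul_le {r g x F y : ℝ} (hx : 0 < x) (hr : 0 ≤ r) (hg : g * x ≤ F)
    (hF : r * F ≤ y) : r * g ≤ y / x := by
  rw [le_div_iff₀ hx, mul_assoc]
  exact (mul_le_mul_of_nonneg_left hg hr).trans hF

end ResilientMatroid

open ResilientMatroid in
theorem theorem1 :
    ∃ C : ℕ, ∀ (V : Type u) [Fintype V] [DecidableEq V] (M M' : Matroid V)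
      (_ : M.E = Set.univ) (_ : M'.E = Set.univ) (_ : ResilientMatroid.Admissible M M')
      (f : Finset V → ℝ) (_ : Monotone f) (_ : f ∅ = 0) (_ : ∀ A, 0 ≤ f A)
      (α β : ℕ) (_ : M.eRank = α) (_ : M'.eRank = β),
      -- the algorithm has an execution, and for every execution:
      (∃ (A : Finset V) (n : ℕ),
        ResilientMatroid.Runs f (ResilientMatroid.algorithm M M') A n) ∧
      ∀ (A : Finset V) (n : ℕ),
        ResilientMatroid.Runs f (ResilientMatroid.algorithm M M') A n →
        -- running time and feasibility
        n ≤ C * Fintype.card V ^ 2 ∧ M.Indep (A : Set V) ∧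
        -- approximation performance
        ∀ B : Finset V, ResilientMatroid.IsWorstRemoval f M' A B →
          0 < ResilientMatroid.optValue f M M' →
          -- submodular functions, with the full factor `h(α, β)`
          (ResilientMatroid.IsSubmodular f → ResilientMatroid.Budgeted M M' →
            (ResilientMatroid.IsUniform M →
              max (1 - ResilientMatroid.curvature f) (ResilientMatroid.hBound α β) *
                  ResilientMatroid.expRatio (ResilientMatroid.curvature f) ≤
                f (A \ B) / ResilientMatroid.optValue f M M') ∧
            max (1 - ResilientMatroid.curvature f) (ResilientMatroid.hBound α β) /
                (1 + ResilientMatroid.curvature f) ≤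
              f (A \ B) / ResilientMatroid.optValue f M M') ∧
          -- submodular functions, with `1/(1+β)` for `h(α, β)`, for any removal budgets
          (ResilientMatroid.IsSubmodular f →
            (ResilientMatroid.IsUniform M →
              max (1 - ResilientMatroid.curvature f) (1 / (1 + (β : ℝ))) *
                  ResilientMatroid.expRatio (ResilientMatroid.curvature f) ≤
                f (A \ B) / ResilientMatroid.optValue f M M') ∧
            max (1 - ResilientMatroid.curvature f) (1 / (1 + (β : ℝ))) /
                (1 + ResilientMatroid.curvature f) ≤
              f (A \ B) / ResilientMatroid.optValue f M M') ∧
          -- monotone functions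
          (1 - ResilientMatroid.totalCurvature f) ^ 3 ≤
            f (A \ B) / ResilientMatroid.optValue f M M' := by
  refine ⟨2, ?_⟩
  intro V _ _ M M' _ _ hadm f hmono h0 hf α β hα hβ
  refine ⟨exists_runs_algorithm f M M', fun A n hrun => ?_⟩
  obtain ⟨hn, A₁, A₂, rfl, hA₁, hA₂, hdisj, hA⟩ := algorithm_spec hrun
  refine ⟨hn, hA, ?_⟩
  rintro B ⟨⟨-, hB⟩, -⟩ hopt
  have hsum := hA₁.sum_le_sum_sdiff hadm hf hdisj hA hB
  -- a surviving fraction `r` of the greedy set yields all the bounds for submodular functions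
  have hcomb : ∀ r : ℝ, IsSubmodular f → r * f A₂ ≤ f ((A₁ ∪ A₂) \ B) →
      (IsUniform M → max (1 - curvature f) r * expRatio (curvature f) ≤
        f ((A₁ ∪ A₂) \ B) / optValue f M M') ∧
      max (1 - curvature f) r / (1 + curvature f) ≤
        f ((A₁ ∪ A₂) \ B) / optValue f M M' := by
    intro r hsub hr
    have hκ := sub_nonneg.2 (curvature_le_one hmono hf)
    have hmax : max (1 - curvature f) r * f A₂ ≤ f ((A₁ ∪ A₂) \ B) := by
      rw [max_mul_of_nonneg _ _ (hf _)]
      refine max_le ?_ hr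
      have h1 := hsub.le_sum h0 ∅ A₂
      rw [Finset.empty_union, h0, zero_add] at h1
      exact (mul_le_mul_of_nonneg_left (h1.trans hsum) hκ).trans
        (mul_sum_le h0 (fun v X hv => one_sub_curvature_mul_le hmono hf hsub hv) _)
    refine ⟨fun hM => ?_, ?_⟩
    · exact mul_le_div_of_mul_le hopt (hκ.trans (le_max_left _ _))
        (hA₂.expRatio_mul_optValue_le hadm hM hmono hsub h0 hf hA₁.indep hA₁.indep') hmax
    · rw [div_eq_mul_one_div]
      exact mul_le_div_of_mul_le hopt (hκ.trans (le_max_left _ _))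
        (hA₂.optValue_le hadm hmono hsub h0 hf hA₁.indep hA₁.indep') hmax
  have hrank : IsSubmodular f → 1 / (1 + (β : ℝ)) * f A₂ ≤ f ((A₁ ∪ A₂) \ B) := by
    intro hsub
    rw [one_div_mul_eq_div, div_le_iff₀' (by positivity)]
    exact hA₁.le_one_add_rank_mul hadm hmono hsub h0 hf hβ hdisj hA hB
  refine ⟨fun hsub hbud => hcomb _ hsub ?_, fun hsub => hcomb _ hsub (hrank hsub), ?_⟩
  · rw [hBound, max_mul_of_nonneg _ _ (hf _)]
    exact max_le (hrank hsub)
      (hA₁.one_div_rank_sub_mul_le hadm hbud hmono hsub h0 hf hα hβ hdisj hA hB)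
  · have he := sub_nonneg.2 (totalCurvature_le_one hmono)
    have hsingle : ∀ v, f (insert v ∅) - f ∅ = f {v} := fun v => by
      rw [h0, sub_zero, insert_empty_eq]
    have h1 : (1 - totalCurvature f) * ∑ v ∈ (A₁ ∪ A₂) \ B, f {v} ≤ f ((A₁ ∪ A₂) \ B) :=
      mul_sum_le h0 (fun v X hv => by
        rw [← hsingle]
        exact one_sub_totalCurvature_mul_le hmono hv (Finset.notMem_empty v)) _
    have h2 : (1 - totalCurvature f) * f A₂ ≤ ∑ v ∈ A₂, f {v} := by
      obtain ⟨g, hg, hgX⟩ := exists_sum_gain_eq h0 A₂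
      rw [← hg, Finset.mul_sum]
      refine Finset.sum_le_sum fun v hv => ?_
      obtain ⟨X, hvX, hX⟩ := hgX v hv
      rw [hX, ← hsingle]
      exact one_sub_totalCurvature_mul_le hmono (Finset.notMem_empty v) hvX
    rw [pow_succ]
    refine mul_le_div_of_mul_le hopt (sq_nonneg _)
      (hA₂.totalCurvature_mul_optValue_le hadm hmono h0 hA₁.indep hA₁.indep') ?_
    rw [pow_two, mul_assoc]
    exact (mul_le_mul_of_nonneg_left (h2.trans hsum) he).trans h1
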